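/- Let $n\ge 1$, $m\ge 0$, let $H\in\mathbb R^{n\times n}$ be symmetric positive semidefinite, $A\in\mathbb R^{m\times n}$, $b\in\mathbb R^m$, $c\in\mathbb R^n$, and let $\|\cdot\|$ be the Euclidean norm. Consider the primal-dual pair of convex quadratic programs $$\text{(QP)}\qquad \min_x\ \tfrac12x^THx+c^Tx\ \text{ s.t. } Ax=b,\ x\ge 0,\qquad\qquad \max_{(x,y,s)}\ b^Ty-\tfrac12x^THx\ \text{ s.t. } A^Ty+s-Hx=c,\ s\ge 0 .$$ An optimal solution of (QP) is a triple $(x^*,y^*,s^*)$ such that $x^*$ solves the primal problem and $(x^*,y^*,s^*)$ solves the dual problem. Assume that (QP) has an optimal solution. For $\lambda\in\mathbb R^n$ with $\lambda\ge 0$, put $\mu_\lambda=\frac{(x+\lambda)^T(s+\lambda)}{n}$, and for $\gamma\in(0,1)$ let $\mathcal N(\gamma,\lambda)$ be the set of all $(x,y,s)$ with $Ax=b$, $A^Ty+s-Hx=c$, $x+\lambda>0$, $s+\lambda>0$ and $\gamma\mu_\lambda\le (x_i+\lambda_i)(s_i+\lambda_i)\le \mu_\lambda/\gamma$ for $i=1,\dots,n$.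 Let $C_2=\sqrt{n/\gamma}+n$. (a) There exist constants $\tau_p,\tau_d>0$, depending only on $(H,A,b,c)$, such that for all $\gamma\in(0,1)$, all $\lambda\ge 0$ and all $(x,y,s)\in\mathcal N(\gamma,\lambda)$ there is an optimal solution $(x^*,y^*,s^*)$ of (QP) with $$\begin{aligned}\|x-x^*\|&<\tau_p\left(C_2\sqrt{\mu_\lambda}\max(\sqrt{\mu_\lambda},1)+4\|\lambda\|\max(\|\lambda\|,1)\right),\\ \|s-s^*\|&<\tau_d\left(C_2\sqrt{\mu_\lambda}\max(\sqrt{\mu_\lambda},1)+4\|\lambda\|\max(\|\lambda\|,1)\right).\end{aligned}$$ (b) Let $\tau_p,\tau_d>0$ be any constants with the property in (a). Let $\gamma\in(0,1)$, $C>0$, and let $\lambda\ge0$ satisfy $$0<\|\lambda\|<\min\left(1,\frac{C}{8\max(\tau_p,\tau_d)}\right).$$ Let $(x,y,s)\in\mathcal N(\gamma,\lambda)$ with $$\mu_\lambda<\min\left(1,\left(\frac{C}{2\max(\tau_p,\tau_d)\,C_2}\right)^2\right).$$ Then there is an optimal solution $(x^*,y^*,s^*)$ of (QP) such that $$\{i: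 x_i\ge C\}\subseteq I(x^*),\qquad \{i: s_i\ge C\}\subseteq S(s^*),\qquad T(x^*,s^*)\subseteq \{1,\dots,n\}\setminus\left(\{i: s_i\ge C\}\cup\{i: x_i\ge C\}\right),$$ where $I(x^*)=\{i:x^*_i>0\}$, $S(s^*)=\{i:s^*_i>0\}$ and $T(x^*,s^*)=\{1,\dots,n\}\setminus(S(s^*)\cup I(x^*))$. -/

import Mathlib

open scoped Matrix

noncomputable section

namespace PerturbedQP

/-- The data `(H, A, b, c)` of the primal problem
`min (1/2) xᵀHx + cᵀx` subject to `Ax = b`, `x ≥ 0`, with `n` variables and `m` equations. -/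
structure Data (m n : ℕ) where
  H : Matrix (Fin n) (Fin n) ℝ
  A : Matrix (Fin m) (Fin n) ℝ
  b : Fin m → ℝ
  c : Fin n → ℝ

/-- The Euclidean norm (the default norm on `Fin n → ℝ` is the sup norm). -/
def enorm₂ {n : ℕ} (v : Fin n → ℝ) : ℝ := ‖WithLp.toLp 2 v‖

namespace Data

variable {m n : ℕ}

/-- `(1/2) xᵀHx + cᵀx`. -/
def primalObj (P : Data m n) (x : Fin n → ℝ) : ℝ :=
  (1 / 2 : ℝ) * (x ⬝ᵥ (P.H *ᵥ x)) + P.c ⬝ᵥ x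

/-- `bᵀy - (1/2) xᵀHx`. -/
def dualObj (P : Data m n) (x : Fin n → ℝ) (y : Fin m → ℝ) : ℝ :=
  P.b ⬝ᵥ y - (1 / 2 : ℝ) * (x ⬝ᵥ (P.H *ᵥ x))

def PrimalFeasible (P : Data m n) (x : Fin n → ℝ) : Prop :=
  P.A *ᵥ x = P.b ∧ ∀ i, 0 ≤ x i

def DualFeasible (P : Data m n) (x : Fin n → ℝ) (y : Fin m → ℝ) (s : Fin n → ℝ) : Prop :=
  P.Aᵀ *ᵥ y + s - P.H *ᵥ x = P.c ∧ ∀ i, 0 ≤ s i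

/-- `(x, y, s)` is an optimal solution of the primal-dual pair: `x` minimises the primal problem
and `(x, y, s)` maximises the dual problem. -/
def IsOptimal (P : Data m n) (x : Fin n → ℝ) (y : Fin m → ℝ) (s : Fin n → ℝ) : Prop :=
  (P.PrimalFeasible x ∧ ∀ x', P.PrimalFeasible x' → P.primalObj x ≤ P.primalObj x') ∧
  (P.DualFeasible x y s ∧
    ∀ x' y' s', P.DualFeasible x' y' s' → P.dualObj x' y' ≤ P.dualObj x y)

/-- Strictly feasible points of the problem whose bounds are relaxed to `x ≥ -lam`, `s ≥ -lam`. -/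
def StrictlyFeasible (P : Data m n) (lam : Fin n → ℝ)
    (x : Fin n → ℝ) (y : Fin m → ℝ) (s : Fin n → ℝ) : Prop :=
  P.A *ᵥ x = P.b ∧ P.Aᵀ *ᵥ y + s - P.H *ᵥ x = P.c ∧
    (∀ i, 0 < x i + lam i) ∧ (∀ i, 0 < s i + lam i)

end Data

variable {m n : ℕ}

/-- `μ_λ = (x + λ)ᵀ(s + λ) / n`. -/
def muLam (lam x s : Fin n → ℝ) : ℝ := ((x + lam) ⬝ᵥ (s + lam)) / (n : ℝ)

/-- The symmetric neighbourhood of the perturbed central path. -/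
def Data.InNeighbourhood (P : Data m n) (γ : ℝ) (lam : Fin n → ℝ)
    (x : Fin n → ℝ) (y : Fin m → ℝ) (s : Fin n → ℝ) : Prop :=
  P.StrictlyFeasible lam x y s ∧
    ∀ i, γ * muLam lam x s ≤ (x i + lam i) * (s i + lam i) ∧
      (x i + lam i) * (s i + lam i) ≤ muLam lam x s / γ

/-- `C₂ = √(n/γ) + n`. -/
def C₂ (n : ℕ) (γ : ℝ) : ℝ := Real.sqrt ((n : ℝ) / γ) + (n : ℝ)

/-- `τp`, `τd` are constants for the bound on the distance to the solution set: every point of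
every neighbourhood, for every `γ ∈ (0,1)` and every perturbation `lam ≥ 0`, has an optimal
solution within the stated distances. -/
def Data.IsErrorBound (P : Data m n) (τp τd : ℝ) : Prop :=
  ∀ (γ : ℝ) (lam : Fin n → ℝ) (x : Fin n → ℝ) (y : Fin m → ℝ) (s : Fin n → ℝ),
    0 < γ → γ < 1 → (∀ i, 0 ≤ lam i) → P.InNeighbourhood γ lam x y s →
    ∃ xs ys ss, P.IsOptimal xs ys ss ∧
      enorm₂ (x - xs) <
        τp * (C₂ n γ * Real.sqrt (muLam lam x s) * max (Real.sqrt (muLam lam x s)) 1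
          + 4 * enorm₂ lam * max (enorm₂ lam) 1) ∧
      enorm₂ (s - ss) <
        τd * (C₂ n γ * Real.sqrt (muLam lam x s) * max (Real.sqrt (muLam lam x s)) 1
          + 4 * enorm₂ lam * max (enorm₂ lam) 1)

/-- `I(x) = {i | x_i > 0}`, the primal inactive set. -/
def inactiveSet (x : Fin n → ℝ) : Set (Fin n) := {i | 0 < x i}

/-- `S(s) = {i | s_i > 0}`, the strongly active (dual inactive) set. -/
def stronglyActiveSet (s : Fin n → ℝ) : Set (Fin n) := {i | 0 < s i}

/-- `T(x, s)`, the complement of `S(s) ∪ I(x)`. -/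
def remainingSet (x s : Fin n → ℝ) : Set (Fin n) := (stronglyActiveSet s ∪ inactiveSet x)ᶜ

/-- The predicted inactive set `{i | x_i ≥ C}`. -/
def predInactiveSet (C : ℝ) (x : Fin n → ℝ) : Set (Fin n) := {i | C ≤ x i}

/-- The predicted strongly active set `{i | s_i ≥ C}`. -/
def predStronglyActiveSet (C : ℝ) (s : Fin n → ℝ) : Set (Fin n) := {i | C ≤ s i}

/-- The predicted remaining set, the complement of the two predicted sets. -/
def predRemainingSet (C : ℝ) (x s : Fin n → ℝ) : Set (Fin n) :=
  (predStronglyActiveSet C s ∪ predInactiveSet C x)ᶜ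

end PerturbedQP

end

open scoped Matrix

noncomputable section

namespace PerturbedQP

/-! Part (a) is a global error bound for the solution set. A primal minimiser has Lagrange
multipliers, so solutions can be sought as KKT triples. Each index of a KKT triple has `x i = 0` or
`s i = 0`, so for each set `α` of indices, prescribing `x i = 0` on `α` and `s i = 0` off `α` leaves
a linear system. If that system is feasible, Hoffman's bound makes the distance to it linear in the
residual `E`. If it is infeasible, `E` is at least some `ε > 0`, and a coarse bound `K * (E + 1)`
suffices. That bound (`IsKKT.exists_error_bound_polyhedral`) holds because a fixed KKT point
linearises complementarity. Summing over all `α` gives `IsKKT.exists_error_bound`.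
`InNeighbourhood.residual_le` bounds `E` on the neighbourhood by the bracket in the theorem. Part
(b): the smallness conditions push both distances below `C`, so an entry at least `C` stays positive
at the solution. Both Hoffman's bound and the multipliers come from one alternative,
`hoffman_or_farkas`, proved by Fourier–Motzkin elimination. -/

/-! ### Hoffman's error bound and Farkas certificates. -/

/-- A finite system of inequalities `t i * z ≤ p i` in one unknown whose pairwise eliminations
hold has a solution near any approximate solution. -/
theorem exists_near_of_pairwise {ι : Type*} [Fintype ι] (t p : ι → ℝ) (y M T : ℝ)
    (hM : 0 ≤ M) (hT0 : 0 ≤ T) (hT : ∀ i, t i ≠ 0 → 1 ≤ T * |t i|)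
    (h0 : ∀ i, t i = 0 → 0 ≤ p i)
    (hij : ∀ i j, t i < 0 → 0 < t j → 0 ≤ t j * p i - t i * p j)
    (hy : ∀ i, t i * y ≤ p i + M) :
    ∃ y', |y - y'| ≤ T * M ∧ ∀ i, t i * y' ≤ p i := by
  classical
  -- The witness is the largest lower bound on the unknown, with `y - T * M` added so that it cannot
  -- fall far below `y`.
  set L : Finset ℝ := insert (y - T * M)
    ((Finset.univ.filter (fun i => t i < 0)).image (fun i => p i / t i)) with hL
  have hne : L.Nonempty := ⟨_, Finset.mem_insert_self _ _⟩
  have hTM : 0 ≤ T * M := mul_nonneg hT0 hM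
  have hlow : ∀ i, t i < 0 → p i / t i ≤ y + T * M := by
    intro i hi
    rw [div_le_iff_of_neg hi]
    have h1 := hT i hi.ne
    rw [abs_of_neg hi] at h1
    nlinarith [hy i, mul_le_mul_of_nonneg_right h1 hM]
  refine ⟨L.max' hne, ?_, ?_⟩
  · rw [abs_le]
    constructor
    · have : L.max' hne ≤ y + T * M := by
        refine Finset.max'_le _ _ _ fun z hz => ?_
        rw [hL, Finset.mem_insert, Finset.mem_image] at hz
        rcases hz with rfl | ⟨i, hi, rfl⟩
        · linarith
        · exact hlow i (by simpa using hi)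
      linarith
    · have := L.le_max' (y - T * M) (Finset.mem_insert_self _ _)
      linarith
  · intro i
    rcases lt_trichotomy (t i) 0 with hi | hi | hi
    · have : p i / t i ≤ L.max' hne := L.le_max' _ (by
        rw [hL]
        exact Finset.mem_insert_of_mem (Finset.mem_image_of_mem _ (by simpa using hi)))
      rw [div_le_iff_of_neg hi] at this
      linarith
    · rw [hi, zero_mul]
      exact h0 i hi
    · have : L.max' hne ≤ p i / t i := by
        refine Finset.max'_le _ _ _ fun z hz => ?_
        rw [hL, Finset.mem_insert, Finset.mem_image] at hz
        rw [le_div_iff₀ hi]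
        rcases hz with rfl | ⟨j, hj, rfl⟩
        · have h1 := hT i hi.ne'
          rw [abs_of_pos hi] at h1
          nlinarith [hy i, mul_le_mul_of_nonneg_right h1 hM]
        · have hj' : t j < 0 := by simpa using hj
          have h2 := hij j i hj' hi
          rw [div_mul_eq_mul_div, div_le_iff_of_neg hj']
          linarith
      rw [le_div_iff₀ hi] at this
      linarith

/-- Coefficients of the Fourier–Motzkin elimination of a variable with coefficient vector `t`. -/
def elimCoeff {ι : Type*} [DecidableEq ι] (t : ι → ℝ) : (ι × ι) ⊕ ι → ι → ℝ
  | .inl (i, j) => if t i < 0 ∧ 0 < t j then Pi.single i (t j) + Pi.single j (-t i) else 0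
  | .inr i => if t i = 0 then Pi.single i 1 else 0

theorem elimCoeff_nonneg {ι : Type*} [DecidableEq ι] (t : ι → ℝ) (r : (ι × ι) ⊕ ι) :
    0 ≤ elimCoeff t r := by
  rcases r with ⟨i, j⟩ | i
  · by_cases h : t i < 0 ∧ 0 < t j
    · simp only [elimCoeff, if_pos h]
      exact add_nonneg (Pi.single_nonneg.2 h.2.le) (Pi.single_nonneg.2 (by linarith [h.1]))
    · simp [elimCoeff, if_neg h]
  · by_cases h : t i = 0
    · simp [elimCoeff, if_pos h]
    · simp [elimCoeff, if_neg h]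

theorem elimCoeff_dotProduct_self {ι : Type*} [Fintype ι] [DecidableEq ι] (t : ι → ℝ)
    (r : (ι × ι) ⊕ ι) : elimCoeff t r ⬝ᵥ t = 0 := by
  rcases r with ⟨i, j⟩ | i
  · by_cases h : t i < 0 ∧ 0 < t j
    · simp only [elimCoeff, if_pos h, add_dotProduct, single_dotProduct]
      ring
    · simp [elimCoeff, if_neg h]
  · by_cases h : t i = 0
    · simp [elimCoeff, h]
    · simp [elimCoeff, if_neg h]

/-- Hoffman's error bound or a Farkas certificate of infeasibility, for a finite system of
linear inequalities. -/
theorem hoffman_or_farkas (k : ℕ) : ∀ {ι : Type} [Fintype ι] (a : ι → Fin k → ℝ) (d : ι → ℝ),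
    (∃ κ, 0 ≤ κ ∧ ∀ δ x, 0 ≤ δ → (∀ i, a i ⬝ᵥ x ≤ d i + δ) →
      ∃ x', (∀ i, a i ⬝ᵥ x' ≤ d i) ∧ ∀ j, |x j - x' j| ≤ κ * δ) ∨
    (∃ w : ι → ℝ, 0 ≤ w ∧ (∀ x, ∑ i, w i * (a i ⬝ᵥ x) = 0) ∧ w ⬝ᵥ d < 0) := by
  induction k with
  | zero =>
    intro ι _ a d
    classical
    by_cases h : ∀ i, 0 ≤ d i
    · exact Or.inl ⟨0, le_rfl, fun δ x _ _ => ⟨x, fun i => by simpa using h i, fun j => j.elim0⟩⟩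
    · push Not at h
      obtain ⟨i, hi⟩ := h
      exact Or.inr ⟨Pi.single i 1, by simp, fun x => by simp, by simpa using hi⟩
  | succ k ih =>
    intro ι _ a d
    classical
    set t : ι → ℝ := fun i => a i 0 with ht
    set R := elimCoeff t with hR
    have hR0 : ∀ r i, 0 ≤ R r i := fun r i => elimCoeff_nonneg t r i
    have split : ∀ i (x : Fin (k + 1) → ℝ),
        a i ⬝ᵥ x = t i * x 0 + Fin.tail (a i) ⬝ᵥ Fin.tail x := fun i x => by
      simp only [dotProduct, Fin.sum_univ_succ, ht]; rfl
    have comb : ∀ r (x : Fin k → ℝ), (fun j => ∑ i, R r i * Fin.tail (a i) j) ⬝ᵥ x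
        = ∑ i, R r i * (Fin.tail (a i) ⬝ᵥ x) := fun r x => by
      simp only [dotProduct, Finset.sum_mul, Finset.mul_sum]
      rw [Finset.sum_comm]
      simp only [mul_assoc]
    have comb' : ∀ r (x : Fin (k + 1) → ℝ), ∑ i, R r i * (Fin.tail (a i) ⬝ᵥ Fin.tail x)
        = ∑ i, R r i * (a i ⬝ᵥ x) := fun r x => by
      have h : ∑ i, R r i * (t i * x 0) = 0 := by
        have := elimCoeff_dotProduct_self t r
        simp only [dotProduct] at this
        simp only [← mul_assoc, ← Finset.sum_mul]
        rw [hR, this, zero_mul]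
      simp only [split, mul_add, Finset.sum_add_distrib, h, zero_add]
    -- The rows of `R` cancel the variable `x 0`, so the eliminated system lives in dimension `k`.
    rcases ih (ι := (ι × ι) ⊕ ι) (fun r j => ∑ i, R r i * Fin.tail (a i) j)
      (fun r => R r ⬝ᵥ d) with ⟨κ, hκ, H⟩ | ⟨w, hw, hw0, hwd⟩
    · left
      set K : ℝ := ∑ r, ∑ i, R r i with hK
      have hK0 : 0 ≤ K := Finset.sum_nonneg fun r _ => Finset.sum_nonneg fun i _ => hR0 r i
      set T : ℝ := ∑ i, |t i|⁻¹ with hT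
      have hT0 : 0 ≤ T := Finset.sum_nonneg fun i _ => by positivity
      set N : ℝ := ∑ i, ∑ j, |Fin.tail (a i) j| with hN
      have hN0 : 0 ≤ N := Finset.sum_nonneg fun r _ => Finset.sum_nonneg fun i _ => abs_nonneg _
      -- `κ * K` controls the tail. Moving the tail disturbs each row by at most `N * (κ * (K *
      -- δ))`, and `T` turns the resulting slack into a displacement of `x 0`.
      refine ⟨κ * K + T * (1 + N * (κ * K)), by positivity, fun δ x hδ hx => ?_⟩
      obtain ⟨x', hx', hd⟩ := H (K * δ) (Fin.tail x) (by positivity) (fun r => by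
        rw [comb, comb']
        have h1 : ∑ i, R r i * (a i ⬝ᵥ x) ≤ ∑ i, R r i * (d i + δ) :=
          Finset.sum_le_sum fun i _ => mul_le_mul_of_nonneg_left (hx i) (hR0 r i)
        have h2 : ∑ i, R r i ≤ K := Finset.single_le_sum
          (f := fun r => ∑ i, R r i)
          (fun r _ => Finset.sum_nonneg fun i _ => hR0 r i) (Finset.mem_univ r)
        simp only [mul_add, Finset.sum_add_distrib, ← Finset.sum_mul] at h1
        have h3 := mul_le_mul_of_nonneg_right h2 hδ
        simp only [dotProduct] at h1 ⊢
        linarith)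
      simp only [comb] at hx'
      have hpR : ∀ r, 0 ≤ R r ⬝ᵥ (fun i => d i - Fin.tail (a i) ⬝ᵥ x') := fun r => by
        have := hx' r
        simp only [dotProduct, mul_sub, Finset.sum_sub_distrib] at this ⊢
        linarith
      obtain ⟨y', hy', hy⟩ := exists_near_of_pairwise t
        (fun i => d i - Fin.tail (a i) ⬝ᵥ x') (x 0) (δ + N * (κ * (K * δ))) T
        (by positivity) hT0
        (fun i hi => by
          have h1 : |t i|⁻¹ ≤ T := Finset.single_le_sum (f := fun i => |t i|⁻¹)
            (fun i _ => by positivity) (Finset.mem_univ i)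
          have h2 := mul_le_mul_of_nonneg_right h1 (abs_nonneg (t i))
          rwa [inv_mul_cancel₀ (abs_ne_zero.2 hi)] at h2)
        (fun i hi => by simpa [hR, elimCoeff, hi] using hpR (.inr i))
        (fun i j hi hj => by
          have := hpR (.inl (i, j))
          simp only [hR, elimCoeff, hi, hj, and_self, if_true, add_dotProduct,
            single_dotProduct] at this
          linarith)
        (fun i => by
          have h1 := hx i
          rw [split] at h1
          have h2 : Fin.tail (a i) ⬝ᵥ x' - Fin.tail (a i) ⬝ᵥ Fin.tail x
              ≤ N * (κ * (K * δ)) := by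
            rw [← dotProduct_sub]
            calc Fin.tail (a i) ⬝ᵥ (x' - Fin.tail x)
                ≤ ∑ j, |Fin.tail (a i) j| * (κ * (K * δ)) := Finset.sum_le_sum fun j _ => by
                  refine (le_abs_self _).trans ?_
                  rw [abs_mul, Pi.sub_apply, abs_sub_comm]
                  exact mul_le_mul_of_nonneg_left (hd j) (abs_nonneg _)
              _ ≤ N * (κ * (K * δ)) := by
                  rw [← Finset.sum_mul]
                  refine mul_le_mul_of_nonneg_right ?_ (by positivity)
                  exact Finset.single_le_sum (f := fun i => ∑ j, |Fin.tail (a i) j|)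
                    (fun i _ => Finset.sum_nonneg fun j _ => abs_nonneg _) (Finset.mem_univ i)
          linarith)
      refine ⟨Fin.cons y' x', fun i => ?_, fun j => ?_⟩
      · rw [split]
        simp only [Fin.cons_zero, Fin.tail_cons]
        linarith [hy i]
      · have e1 : 0 ≤ κ * K * δ := by positivity
        have e2 : 0 ≤ T * (1 + N * (κ * K)) * δ := by positivity
        refine Fin.cases ?_ (fun j => ?_) j
        · simp only [Fin.cons_zero]
          nlinarith [hy']
        · simp only [Fin.cons_succ]
          have := hd j
          simp only [Fin.tail] at this
          nlinarith [this]
    -- Nonnegative combinations of rows compose, so a certificate for the eliminated system pulls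
    -- back along `R`.
    · right
      refine ⟨fun i => ∑ r, w r * R r i,
        fun i => Finset.sum_nonneg fun r _ => mul_nonneg (hw r) (hR0 r i), fun x => ?_, ?_⟩
      · rw [← hw0 (Fin.tail x)]
        simp only [comb, comb', Finset.sum_mul, Finset.mul_sum]
        rw [Finset.sum_comm]
        simp only [mul_assoc]
      · refine lt_of_eq_of_lt ?_ hwd
        simp only [dotProduct, Finset.sum_mul, Finset.mul_sum]
        rw [Finset.sum_comm]
        simp only [mul_assoc]

/-- The error bound on a finite-dimensional normed space. -/
theorem hoffman_or_farkas_finiteDimensional {V : Type*} [NormedAddCommGroup V] [NormedSpace ℝ V]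
    [FiniteDimensional ℝ V] {ι : Type} [Fintype ι] (g : ι → V →ₗ[ℝ] ℝ) (d : ι → ℝ) :
    (∃ κ, 0 ≤ κ ∧ ∀ δ x, 0 ≤ δ → (∀ i, g i x ≤ d i + δ) →
      ∃ x', (∀ i, g i x' ≤ d i) ∧ ‖x - x'‖ ≤ κ * δ) ∨
    (∃ w : ι → ℝ, 0 ≤ w ∧ (∀ x, ∑ i, w i * g i x = 0) ∧ w ⬝ᵥ d < 0) := by
  set B := Module.finBasis ℝ V
  set e := B.equivFunL
  set E : (Fin (Module.finrank ℝ V) → ℝ) →L[ℝ] V := e.symm.toContinuousLinearMap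
  have hg : ∀ i x, (fun j => g i (B j)) ⬝ᵥ e x = g i x := fun i x => by
    conv_rhs => rw [← B.sum_equivFun x]
    simp only [map_sum, map_smul, dotProduct, smul_eq_mul]
    exact Finset.sum_congr rfl fun j _ => mul_comm _ _
  rcases hoffman_or_farkas _ (fun i j => g i (B j)) d with ⟨κ, hκ, H⟩ | ⟨w, hw, hw0, hwd⟩
  · refine Or.inl ⟨‖E‖ * κ, by positivity, fun δ x hδ hx => ?_⟩
    obtain ⟨x', hx', hd⟩ := H δ (e x) hδ (fun i => by rw [hg]; exact hx i)
    refine ⟨e.symm x', fun i => ?_, ?_⟩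
    · rw [← hg, e.apply_symm_apply]
      exact hx' i
    · have h1 : x - e.symm x' = E (e x - x') := by simp [E]
      rw [h1, mul_assoc]
      refine (E.le_opNorm _).trans
        (mul_le_mul_of_nonneg_left ?_ (norm_nonneg _))
      exact (pi_norm_le_iff_of_nonneg (by positivity)).2 fun j => hd j
  · refine Or.inr ⟨w, hw, fun x => ?_, hwd⟩
    simpa only [hg] using hw0 (e x)

/-- For a finite system of equations and inequalities, either Hoffman's bound holds or the system
cannot be satisfied up to an arbitrarily small error. -/
theorem hoffman_or_infeasible {V : Type*} [NormedAddCommGroup V] [NormedSpace ℝ V]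
    [FiniteDimensional ℝ V] {σ τ : Type} [Fintype σ] [Fintype τ]
    (F : σ → V →ₗ[ℝ] ℝ) (f : σ → ℝ) (g : τ → V →ₗ[ℝ] ℝ) (d : τ → ℝ) :
    (∃ κ, 0 ≤ κ ∧ ∀ δ x, 0 ≤ δ → (∀ j, |F j x - f j| ≤ δ) → (∀ i, g i x ≤ d i + δ) →
      ∃ x', (∀ j, F j x' = f j) ∧ (∀ i, g i x' ≤ d i) ∧ ‖x - x'‖ ≤ κ * δ) ∨
    (∃ ε, 0 < ε ∧ ∀ δ x, (∀ j, |F j x - f j| ≤ δ) → (∀ i, g i x ≤ d i + δ) → ε ≤ δ) := by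
  set G : σ ⊕ σ ⊕ τ → V →ₗ[ℝ] ℝ := Sum.elim F (Sum.elim (fun j => -F j) g) with hG
  set D : σ ⊕ σ ⊕ τ → ℝ := Sum.elim f (Sum.elim (fun j => -f j) d) with hD
  have hGD : ∀ δ x, (∀ j, |F j x - f j| ≤ δ) → (∀ i, g i x ≤ d i + δ) →
      ∀ r, G r x ≤ D r + δ := by
    rintro δ x h1 h2 (j | j | i)
    · have := (abs_le.1 (h1 j)).2
      simp only [hG, hD, Sum.elim_inl]
      linarith
    · have := (abs_le.1 (h1 j)).1
      simp only [hG, hD, Sum.elim_inl, Sum.elim_inr, LinearMap.neg_apply]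
      linarith
    · exact h2 i
  rcases hoffman_or_farkas_finiteDimensional G D with ⟨κ, hκ, H⟩ | ⟨w, hw, hw0, hwd⟩
  · refine Or.inl ⟨κ, hκ, fun δ x hδ h1 h2 => ?_⟩
    obtain ⟨x', hx', hd⟩ := H δ x hδ (hGD δ x h1 h2)
    refine ⟨x', fun j => ?_, fun i => hx' (.inr (.inr i)), hd⟩
    have e1 := hx' (.inl j)
    have e2 := hx' (.inr (.inl j))
    simp only [hG, hD, Sum.elim_inl, Sum.elim_inr, LinearMap.neg_apply] at e1 e2
    linarith
  · right
    have hW : 0 ≤ ∑ i, w i := Finset.sum_nonneg fun i _ => hw i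
    -- Pairing the certificate with the approximate inequalities gives `0 ≤ w ⬝ᵥ D + δ * ∑ i, w i`;
    -- the `+ 1` only keeps the denominator positive.
    refine ⟨-(w ⬝ᵥ D) / (∑ i, w i + 1), div_pos (by linarith) (by linarith),
      fun δ x h1 h2 => ?_⟩
    have key : ∑ i, w i * G i x ≤ ∑ i, w i * (D i + δ) :=
      Finset.sum_le_sum fun i _ => mul_le_mul_of_nonneg_left (hGD δ x h1 h2 i) (hw i)
    rw [hw0 x] at key
    simp only [mul_add, Finset.sum_add_distrib, ← Finset.sum_mul] at key
    simp only [dotProduct] at hwd ⊢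
    rw [div_le_iff₀ (by linarith)]
    have hδ : 0 ≤ δ := by
      by_contra hδ
      nlinarith
    linarith

/-! ### Optimality, KKT conditions and Lagrange multipliers. -/

open Filter Topology

variable {m n : ℕ}

/-- The Karush–Kuhn–Tucker conditions of the primal-dual pair. -/
structure Data.IsKKT (P : Data m n) (x : Fin n → ℝ) (y : Fin m → ℝ) (s : Fin n → ℝ) : Prop where
  primal : P.A *ᵥ x = P.b
  dual : P.Aᵀ *ᵥ y + s - P.H *ᵥ x = P.c
  x_nonneg : ∀ i, 0 ≤ x i
  s_nonneg : ∀ i, 0 ≤ s i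
  compl : x ⬝ᵥ s = 0

theorem dotProduct_mulVec_comm_of_posSemidef {H : Matrix (Fin n) (Fin n) ℝ} (hH : H.PosSemidef)
    (u v : Fin n → ℝ) : u ⬝ᵥ (H *ᵥ v) = v ⬝ᵥ (H *ᵥ u) := by
  have hT : Hᵀ = H := by simpa using hH.isHermitian.eq
  rw [Matrix.dotProduct_mulVec, ← Matrix.mulVec_transpose, hT, dotProduct_comm]

theorem quadForm_nonneg {H : Matrix (Fin n) (Fin n) ℝ} (hH : H.PosSemidef)
    (u : Fin n → ℝ) : 0 ≤ u ⬝ᵥ (H *ᵥ u) := by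
  simpa using hH.dotProduct_mulVec_nonneg u

namespace Data

variable {P : Data m n}

/-- The duality gap. -/
theorem primalObj_sub_dualObj (hH : P.H.PosSemidef) {x' x s : Fin n → ℝ} {y : Fin m → ℝ}
    (hp : P.A *ᵥ x' = P.b) (hd : P.Aᵀ *ᵥ y + s - P.H *ᵥ x = P.c) :
    P.primalObj x' - P.dualObj x y
      = (1 / 2) * ((x' - x) ⬝ᵥ (P.H *ᵥ (x' - x))) + x' ⬝ᵥ s := by
  have h1 : P.c ⬝ᵥ x' = P.b ⬝ᵥ y + x' ⬝ᵥ s - x' ⬝ᵥ (P.H *ᵥ x) := by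
    rw [← hd, ← hp, sub_dotProduct, add_dotProduct, Matrix.mulVec_transpose,
      ← Matrix.dotProduct_mulVec, dotProduct_comm y, dotProduct_comm s, dotProduct_comm _ x']
  have h2 := dotProduct_mulVec_comm_of_posSemidef hH x x'
  simp only [primalObj, dualObj, Matrix.mulVec_sub, sub_dotProduct, dotProduct_sub, h1, h2]
  ring

/-- The duality gap is nonnegative for every feasible pair and vanishes at a KKT triple. -/
theorem IsKKT.isOptimal (hH : P.H.PosSemidef) {x s : Fin n → ℝ} {y : Fin m → ℝ}
    (h : P.IsKKT x y s) : P.IsOptimal x y s := by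
  have h0 := primalObj_sub_dualObj hH h.primal h.dual
  simp only [sub_self, Matrix.mulVec_zero, dotProduct_zero, h.compl] at h0
  refine ⟨⟨⟨h.primal, h.x_nonneg⟩, fun x' hx' => ?_⟩, ⟨h.dual, h.s_nonneg⟩,
    fun x' y' s' h' => ?_⟩
  · have h1 := primalObj_sub_dualObj hH hx'.1 h.dual
    have h2 := quadForm_nonneg hH (x' - x)
    have h3 : 0 ≤ x' ⬝ᵥ s := dotProduct_nonneg_of_nonneg hx'.2 h.s_nonneg
    linarith
  · have h1 := primalObj_sub_dualObj hH h.primal h'.1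
    have h2 := quadForm_nonneg hH (x - x')
    have h3 : 0 ≤ x ⬝ᵥ s' := dotProduct_nonneg_of_nonneg h.x_nonneg h'.2
    linarith

/-- At a primal minimiser the gradient is nonnegative along feasible directions. -/
theorem gradient_nonneg (hH : P.H.PosSemidef) {x v : Fin n → ℝ} (hx : P.PrimalFeasible x)
    (hmin : ∀ x', P.PrimalFeasible x' → P.primalObj x ≤ P.primalObj x')
    (hv : P.A *ᵥ v = 0) (hv0 : ∀ i, x i = 0 → 0 ≤ v i) :
    0 ≤ (P.H *ᵥ x + P.c) ⬝ᵥ v := by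
  have hfeas : ∀ᶠ t : ℝ in 𝓝[>] 0, ∀ i, 0 ≤ x i + t * v i := by
    rw [eventually_all]
    intro i
    rcases (hx.2 i).eq_or_lt with hi | hi
    · filter_upwards [self_mem_nhdsWithin] with t ht
      rw [← hi, zero_add]
      exact mul_nonneg (le_of_lt ht) (hv0 i hi.symm)
    · have hc : Tendsto (fun t : ℝ => x i + t * v i) (𝓝[>] 0) (𝓝 (x i + 0 * v i)) :=
        (Continuous.tendsto (by fun_prop) 0).mono_left nhdsWithin_le_nhds
      rw [zero_mul, add_zero] at hc
      exact (hc.eventually (lt_mem_nhds hi)).mono fun t ht => ht.le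
  have hlim : Tendsto (fun t : ℝ => (P.H *ᵥ x + P.c) ⬝ᵥ v + t * ((1 / 2) * (v ⬝ᵥ (P.H *ᵥ v))))
      (𝓝[>] 0) (𝓝 ((P.H *ᵥ x + P.c) ⬝ᵥ v + 0 * ((1 / 2) * (v ⬝ᵥ (P.H *ᵥ v))))) :=
    (Continuous.tendsto (by fun_prop) 0).mono_left nhdsWithin_le_nhds
  rw [zero_mul, add_zero] at hlim
  refine ge_of_tendsto hlim ?_
  -- The limit is that of the difference quotient of the objective along `v`, nonnegative for small
  -- `t > 0` by minimality.
  filter_upwards [hfeas, self_mem_nhdsWithin] with t ht (ht0 : 0 < t)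
  have h1 := hmin (x + t • v) ⟨by rw [Matrix.mulVec_add, Matrix.mulVec_smul, hv, hx.1]; simp,
    fun i => by simpa using ht i⟩
  have h2 := dotProduct_mulVec_comm_of_posSemidef hH x v
  have h3 : P.primalObj (x + t • v) = P.primalObj x
      + t * ((P.H *ᵥ x + P.c) ⬝ᵥ v + t * ((1 / 2) * (v ⬝ᵥ (P.H *ᵥ v)))) := by
    simp only [primalObj, Matrix.mulVec_add, Matrix.mulVec_smul, add_dotProduct, dotProduct_add,
      smul_dotProduct, dotProduct_smul, smul_eq_mul, h2, dotProduct_comm (P.H *ᵥ x) v]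
    ring
  rw [h3] at h1
  exact nonneg_of_mul_nonneg_right (by linarith) ht0

/-- A primal minimiser has Lagrange multipliers. -/
theorem exists_isKKT (hH : P.H.PosSemidef) {x : Fin n → ℝ} (hx : P.PrimalFeasible x)
    (hmin : ∀ x', P.PrimalFeasible x' → P.primalObj x ≤ P.primalObj x') :
    ∃ y s, P.IsKKT x y s := by
  set q := P.H *ᵥ x + P.c with hq
  set e : Fin n → Fin n → ℝ := fun i => if x i = 0 then -Pi.single i 1 else 0 with he
  -- The system describes a feasible direction `v` with `q ⬝ᵥ v ≤ -1`. In the Hoffman case it has a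
  -- solution, since `v = 0` satisfies it up to error `1`; this contradicts minimality.
  rcases hoffman_or_farkas n (ι := Fin m ⊕ Fin m ⊕ Fin n ⊕ Unit)
    (Sum.elim (fun j => P.A j) (Sum.elim (fun j => -P.A j) (Sum.elim e fun _ => q)) :
      Fin m ⊕ Fin m ⊕ Fin n ⊕ Unit → Fin n → ℝ)
    (Sum.elim 0 (Sum.elim 0 (Sum.elim 0 fun _ => -1))) with ⟨κ, -, H⟩ | ⟨w, hw, hw0, hwd⟩
  · exfalso
    obtain ⟨v, hv, -⟩ := H 1 0 zero_le_one (by rintro (j | j | j | j) <;> simp)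
    have h1 := gradient_nonneg (v := v) hH hx hmin (by
      ext j
      have e1 : P.A j ⬝ᵥ v ≤ 0 := hv (.inl j)
      have e2 : (-P.A j) ⬝ᵥ v ≤ 0 := hv (.inr (.inl j))
      rw [neg_dotProduct] at e2
      exact le_antisymm e1 (neg_nonpos.1 e2)) (fun i hi => by
      have : e i ⬝ᵥ v ≤ 0 := hv (.inr (.inr (.inl i)))
      simpa [he, hi] using this)
    have h2 : q ⬝ᵥ v ≤ -1 := hv (.inr (.inr (.inr ())))
    linarith
  -- `θ` is the weight on the descent row, the only row with a nonzero right-hand side. Dividing the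
  -- certificate by `θ` yields the multipliers.
  · set θ := w (.inr (.inr (.inr ()))) with hθ
    have hθ0 : 0 < θ := by
      simpa [dotProduct, Fintype.sum_sum_type] using hwd
    set s : Fin n → ℝ := fun i => if x i = 0 then θ⁻¹ * w (.inr (.inr (.inl i))) else 0 with hs
    set y : Fin m → ℝ := fun j => θ⁻¹ * (w (.inr (.inl j)) - w (.inl j)) with hy
    have key : P.Aᵀ *ᵥ y + s = q := by
      refine dotProduct_eq _ _ fun v => ?_
      have h1 : ∑ j, w (.inl j) * (P.A j ⬝ᵥ v) + (∑ j, w (.inr (.inl j)) * (-P.A j ⬝ᵥ v)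
          + (∑ i, w (.inr (.inr (.inl i))) * (e i ⬝ᵥ v) + θ * (q ⬝ᵥ v))) = 0 := by
        have := hw0 v
        simp only [Fintype.sum_sum_type, Finset.univ_unique, Finset.sum_singleton] at this
        exact this
      have h2 : (P.Aᵀ *ᵥ y) ⬝ᵥ v
          = θ⁻¹ * (∑ j, w (.inr (.inl j)) * (P.A j ⬝ᵥ v) - ∑ j, w (.inl j) * (P.A j ⬝ᵥ v)) := by
        rw [Matrix.mulVec_transpose, ← Matrix.dotProduct_mulVec, ← Finset.sum_sub_distrib,
          Finset.mul_sum]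
        refine Finset.sum_congr rfl fun j _ => ?_
        simp only [hy, Matrix.mulVec]
        ring
      have h3 : s ⬝ᵥ v = -(θ⁻¹ * ∑ i, w (.inr (.inr (.inl i))) * (e i ⬝ᵥ v)) := by
        rw [Finset.mul_sum, ← Finset.sum_neg_distrib]
        refine Finset.sum_congr rfl fun i _ => ?_
        by_cases hi : x i = 0 <;> simp [hs, he, hi, mul_assoc]
      rw [add_dotProduct, h2, h3]
      simp only [neg_dotProduct, mul_neg, Finset.sum_neg_distrib] at h1
      field_simp
      linarith
    refine ⟨y, s, hx.1, by rw [key, hq]; simp, hx.2, fun i => ?_, ?_⟩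
    · simp only [hs]
      split_ifs
      · exact mul_nonneg (inv_nonneg.2 hθ0.le) (hw _)
      · exact le_rfl
    · refine Finset.sum_eq_zero fun i _ => ?_
      by_cases hi : x i = 0 <;> simp [hs, hi]

end Data

/-! ### Error bounds for the solution set. -/

/-- A positive semidefinite quadratic form is a sum of squares of linear forms. -/
theorem exists_sum_sq_of_posSemidef {H : Matrix (Fin n) (Fin n) ℝ} (hH : H.PosSemidef) :
    ∃ (k : ℕ) (v : Fin k → Fin n → ℝ), ∀ w, w ⬝ᵥ (H *ᵥ w) = ∑ i, (v i ⬝ᵥ w) ^ 2 := by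
  obtain ⟨k, v, rfl⟩ := Matrix.posSemidef_iff_eq_sum_vecMulVec.1 hH
  refine ⟨k, v, fun w => ?_⟩
  rw [Matrix.sum_mulVec, dotProduct_sum]
  refine Finset.sum_congr rfl fun i _ => ?_
  simp only [star_trivial, Matrix.vecMulVec_mulVec, dotProduct_smul]
  rw [dotProduct_comm w]
  simp [sq]

namespace Data

/-- Triples `(x, y, s)`. -/
abbrev Triple (m n : ℕ) : Type := (Fin n → ℝ) × (Fin m → ℝ) × (Fin n → ℝ)

/-- The coordinate `x i` of a triple. -/
def xCoord (m : ℕ) (i : Fin n) : Triple m n →ₗ[ℝ] ℝ :=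
  LinearMap.proj i ∘ₗ LinearMap.fst ℝ _ _

/-- The coordinate `s i` of a triple. -/
def sCoord (m : ℕ) (i : Fin n) : Triple m n →ₗ[ℝ] ℝ :=
  LinearMap.proj i ∘ₗ LinearMap.snd ℝ _ _ ∘ₗ LinearMap.snd ℝ _ _

/-- The left-hand sides of the equations `Ax = b` and `Aᵀy + s - Hx = c`. -/
def eqMap (P : Data m n) : Fin m ⊕ Fin n → Triple m n →ₗ[ℝ] ℝ :=
  Sum.elim (fun j => LinearMap.proj j ∘ₗ P.A.mulVecLin ∘ₗ LinearMap.fst ℝ _ _)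
    (fun i => LinearMap.proj i ∘ₗ
      (P.Aᵀ.mulVecLin ∘ₗ LinearMap.fst ℝ _ _ ∘ₗ LinearMap.snd ℝ _ _
        + LinearMap.snd ℝ _ _ ∘ₗ LinearMap.snd ℝ _ _ - P.H.mulVecLin ∘ₗ LinearMap.fst ℝ _ _))

variable {P : Data m n}

theorem eqMap_eq_iff {x s : Fin n → ℝ} {y : Fin m → ℝ} :
    (∀ j, P.eqMap j (x, y, s) = Sum.elim P.b P.c j) ↔
      P.A *ᵥ x = P.b ∧ P.Aᵀ *ᵥ y + s - P.H *ᵥ x = P.c := by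
  rw [Sum.forall, funext_iff, funext_iff]
  rfl

/-- The difference `x - x'` lies in the kernel of `A`, so the `y` part drops out. -/
theorem sub_dotProduct_sub {x x' s s' : Fin n → ℝ} {y y' : Fin m → ℝ}
    (hx : P.A *ᵥ x = P.b) (hs : P.Aᵀ *ᵥ y + s - P.H *ᵥ x = P.c)
    (hx' : P.A *ᵥ x' = P.b) (hs' : P.Aᵀ *ᵥ y' + s' - P.H *ᵥ x' = P.c) :
    (x - x') ⬝ᵥ (s - s') = (x - x') ⬝ᵥ (P.H *ᵥ (x - x')) := by
  have h1 : s - s' = P.H *ᵥ (x - x') - P.Aᵀ *ᵥ (y - y') := by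
    rw [Matrix.mulVec_sub, Matrix.mulVec_sub, sub_eq_sub_iff_add_eq_add,
      eq_sub_of_add_eq' (sub_eq_iff_eq_add.1 hs), eq_sub_of_add_eq' (sub_eq_iff_eq_add.1 hs')]
    abel
  rw [h1, dotProduct_sub, Matrix.mulVec_transpose, dotProduct_comm _ ((y - y') ᵥ* P.A),
    ← Matrix.dotProduct_mulVec, Matrix.mulVec_sub P.A, hx, hx']
  simp

/-- The solution set as a polyhedron, with Hoffman's error bound for it. -/
theorem IsKKT.exists_error_bound_polyhedral (hH : P.H.PosSemidef) {x₀ s₀ : Fin n → ℝ}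
    {y₀ : Fin m → ℝ} (h₀ : P.IsKKT x₀ y₀ s₀) :
    ∃ K, 0 ≤ K ∧ ∀ E x y s, 0 ≤ E → P.A *ᵥ x = P.b → P.Aᵀ *ᵥ y + s - P.H *ᵥ x = P.c →
      (∀ i, -E ≤ x i) → (∀ i, -E ≤ s i) → x ⬝ᵥ s ≤ E →
      ∃ x' y' s', P.IsKKT x' y' s' ∧ ‖(x, y, s) - (x', y', s')‖ ≤ K * (E + 1) := by
  obtain ⟨k, v, hv⟩ := exists_sum_sq_of_posSemidef hH
  -- For `x, s ≥ 0` all terms on the right are nonnegative, so `x ⬝ᵥ s = 0` amounts to the linear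
  -- conditions `v i ⬝ᵥ x = v i ⬝ᵥ x₀` and `s₀ ⬝ᵥ x + x₀ ⬝ᵥ s ≤ 0`.
  have expand : ∀ {x s : Fin n → ℝ} {y : Fin m → ℝ}, P.A *ᵥ x = P.b →
      P.Aᵀ *ᵥ y + s - P.H *ᵥ x = P.c →
      x ⬝ᵥ s = ∑ i, (v i ⬝ᵥ (x - x₀)) ^ 2 + (s₀ ⬝ᵥ x + x₀ ⬝ᵥ s) := fun {x s y} hx hs => by
    have h1 := sub_dotProduct_sub hx hs h₀.primal h₀.dual
    rw [hv] at h1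
    rw [← h1, sub_dotProduct, dotProduct_sub, dotProduct_sub, h₀.compl, dotProduct_comm s₀]
    ring
  set F : (Fin m ⊕ Fin n) ⊕ Fin k → Triple m n →ₗ[ℝ] ℝ :=
    Sum.elim P.eqMap (fun i => dotProductBilin ℝ ℝ (v i) ∘ₗ LinearMap.fst ℝ _ _) with hF
  set f : (Fin m ⊕ Fin n) ⊕ Fin k → ℝ :=
    Sum.elim (Sum.elim P.b P.c) (fun i => v i ⬝ᵥ x₀) with hf
  set g : Fin n ⊕ Fin n ⊕ Unit → Triple m n →ₗ[ℝ] ℝ :=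
    Sum.elim (fun i => -xCoord m i) (Sum.elim (fun i => -sCoord m i)
      (fun _ => dotProductBilin ℝ ℝ s₀ ∘ₗ LinearMap.fst ℝ _ _
        + dotProductBilin ℝ ℝ x₀ ∘ₗ LinearMap.snd ℝ _ _ ∘ₗ LinearMap.snd ℝ _ _)) with hg
  rcases hoffman_or_infeasible F f g 0 with ⟨κ, hκ, hK⟩ | ⟨ε, hε, hinf⟩
  · set S := ∑ i, s₀ i + ∑ i, x₀ i with hS
    have hS0 : 0 ≤ S := add_nonneg (Finset.sum_nonneg fun i _ => h₀.s_nonneg i)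
      (Finset.sum_nonneg fun i _ => h₀.x_nonneg i)
    refine ⟨κ * (1 + S), by positivity, fun E x y s hE hx hs hx0 hs0 hxs => ?_⟩
    have hlow : ∀ {a z : Fin n → ℝ}, (∀ i, 0 ≤ a i) → (∀ i, -E ≤ z i) →
        -((∑ i, a i) * E) ≤ a ⬝ᵥ z := fun {a z} ha hz => by
      rw [Finset.sum_mul, ← Finset.sum_neg_distrib]
      exact Finset.sum_le_sum fun i _ => by
        have := mul_le_mul_of_nonneg_left (hz i) (ha i)
        linarith
    have l1 := hlow h₀.s_nonneg hx0
    have l2 := hlow h₀.x_nonneg hs0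
    have hex := expand hx hs
    have hSE : 0 ≤ S * E := by positivity
    have hD : ∑ i, (v i ⬝ᵥ (x - x₀)) ^ 2 ≤ (1 + S) * E := by
      simp only [hS]
      linarith
    have hD0 : 0 ≤ ∑ i, (v i ⬝ᵥ (x - x₀)) ^ 2 := Finset.sum_nonneg fun i _ => sq_nonneg _
    -- Only the squares of the `v i` residuals are `O(E)`. The residuals themselves may be of order
    -- `√E`, and `E + 1` dominates both `E` and `√E`.
    obtain ⟨⟨x', y', s'⟩, e1, e2, e3⟩ := hK ((1 + S) * (E + 1)) (x, y, s) (by positivity)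
      (by
        rintro (j | i)
        · have : P.eqMap j (x, y, s) - Sum.elim P.b P.c j = 0 :=
            sub_eq_zero.2 (eqMap_eq_iff.2 ⟨hx, hs⟩ j)
          simp only [hF, hf, Sum.elim_inl, this, abs_zero]
          positivity
        · have h1 : (v i ⬝ᵥ (x - x₀)) ^ 2 ≤ ∑ i, (v i ⬝ᵥ (x - x₀)) ^ 2 :=
            Finset.single_le_sum (f := fun i => (v i ⬝ᵥ (x - x₀)) ^ 2)
              (fun i _ => sq_nonneg _) (Finset.mem_univ i)
          change |v i ⬝ᵥ x - v i ⬝ᵥ x₀| ≤ _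
          rw [← dotProduct_sub]
          rw [← sq_abs] at h1
          nlinarith [sq_nonneg (|v i ⬝ᵥ (x - x₀)| - 1), abs_nonneg (v i ⬝ᵥ (x - x₀))])
      (by
        rintro (i | i | i)
        · change -x i ≤ 0 + _
          linarith [hx0 i]
        · change -s i ≤ 0 + _
          linarith [hs0 i]
        · change s₀ ⬝ᵥ x + x₀ ⬝ᵥ s ≤ 0 + _
          linarith)
    obtain ⟨p1, p2⟩ := eqMap_eq_iff.1 fun j => e1 (.inl j)
    have p3 : ∀ i, v i ⬝ᵥ x' = v i ⬝ᵥ x₀ := fun i => e1 (.inr i)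
    have p4 : ∀ i, 0 ≤ x' i := fun i => neg_nonpos.1 (e2 (.inl i))
    have p5 : ∀ i, 0 ≤ s' i := fun i => neg_nonpos.1 (e2 (.inr (.inl i)))
    have p6 : s₀ ⬝ᵥ x' + x₀ ⬝ᵥ s' ≤ 0 := e2 (.inr (.inr ()))
    refine ⟨x', y', s', ⟨p1, p2, p4, p5, le_antisymm ?_ (dotProduct_nonneg_of_nonneg p4 p5)⟩, ?_⟩
    · rw [expand p1 p2]
      simpa [dotProduct_sub, p3] using p6
    · rw [mul_assoc]
      exact e3
  -- The reference point satisfies the system exactly.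
  · exfalso
    refine absurd (hinf 0 (x₀, y₀, s₀) ?_ ?_) (not_le.2 hε)
    · rintro (j | i)
      · have : P.eqMap j (x₀, y₀, s₀) - Sum.elim P.b P.c j = 0 :=
          sub_eq_zero.2 (eqMap_eq_iff.2 ⟨h₀.primal, h₀.dual⟩ j)
        simp only [hF, hf, Sum.elim_inl, this, abs_zero, le_refl]
      · change |v i ⬝ᵥ x₀ - v i ⬝ᵥ x₀| ≤ 0
        simp
    · rintro (i | i | i)
      · change -x₀ i ≤ 0 + 0
        linarith [h₀.x_nonneg i]
      · change -s₀ i ≤ 0 + 0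
        linarith [h₀.s_nonneg i]
      · change s₀ ⬝ᵥ x₀ + x₀ ⬝ᵥ s₀ ≤ 0 + 0
        rw [dotProduct_comm s₀, h₀.compl, add_zero]

/-- The error bound for a fixed complementarity pattern. -/
theorem IsKKT.exists_error_bound_of_pattern (hH : P.H.PosSemidef) {x₀ s₀ : Fin n → ℝ}
    {y₀ : Fin m → ℝ} (h₀ : P.IsKKT x₀ y₀ s₀) (α : Finset (Fin n)) :
    ∃ K, 0 ≤ K ∧ ∀ E x y s, 0 ≤ E → P.A *ᵥ x = P.b → P.Aᵀ *ᵥ y + s - P.H *ᵥ x = P.c →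
      (∀ i, -E ≤ x i) → (∀ i, -E ≤ s i) → (∀ i ∈ α, x i ≤ E) → (∀ i ∉ α, s i ≤ E) →
      x ⬝ᵥ s ≤ E →
      ∃ x' y' s', P.IsKKT x' y' s' ∧ ‖(x, y, s) - (x', y', s')‖ ≤ K * E := by
  set g : Fin n ⊕ Fin n ⊕ Fin n → Triple m n →ₗ[ℝ] ℝ :=
    Sum.elim (fun i => -xCoord m i) (Sum.elim (fun i => -sCoord m i)
      (fun i => if i ∈ α then xCoord m i else sCoord m i)) with hg
  have hres : ∀ E x y s, 0 ≤ E → P.A *ᵥ x = P.b → P.Aᵀ *ᵥ y + s - P.H *ᵥ x = P.c →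
      (∀ i, -E ≤ x i) → (∀ i, -E ≤ s i) → (∀ i ∈ α, x i ≤ E) → (∀ i ∉ α, s i ≤ E) →
      (∀ j, |P.eqMap j (x, y, s) - Sum.elim P.b P.c j| ≤ E) ∧
      ∀ i, g i (x, y, s) ≤ (0 : Fin n ⊕ Fin n ⊕ Fin n → ℝ) i + E := by
    intro E x y s hE hx hs hx0 hs0 hα hα'
    refine ⟨fun j => ?_, ?_⟩
    · rw [sub_eq_zero.2 (eqMap_eq_iff.2 ⟨hx, hs⟩ j), abs_zero]
      exact hE
    · rintro (i | i | i)
      · change -x i ≤ 0 + E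
        linarith [hx0 i]
      · change -s i ≤ 0 + E
        linarith [hs0 i]
      · change (if i ∈ α then xCoord m i else sCoord m i) (x, y, s) ≤ 0 + E
        rw [zero_add]
        split_ifs with hi
        · exact hα i hi
        · exact hα' i hi
  rcases hoffman_or_infeasible P.eqMap (Sum.elim P.b P.c) g 0 with ⟨κ, hκ, hK⟩ | ⟨ε, hε, hinf⟩
  · refine ⟨κ, hκ, fun E x y s hE hx hs hx0 hs0 hα hα' _ => ?_⟩
    obtain ⟨r1, r2⟩ := hres E x y s hE hx hs hx0 hs0 hα hα'
    obtain ⟨⟨x', y', s'⟩, e1, e2, e3⟩ := hK E (x, y, s) hE r1 r2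
    obtain ⟨p1, p2⟩ := eqMap_eq_iff.1 e1
    have p4 : ∀ i, 0 ≤ x' i := fun i => neg_nonpos.1 (e2 (.inl i))
    have p5 : ∀ i, 0 ≤ s' i := fun i => neg_nonpos.1 (e2 (.inr (.inl i)))
    refine ⟨x', y', s', ⟨p1, p2, p4, p5, Finset.sum_eq_zero fun i _ => ?_⟩, e3⟩
    have h : (if i ∈ α then xCoord m i else sCoord m i) (x', y', s') ≤ 0 := e2 (.inr (.inr i))
    split_ifs at h with hi
    · have h : x' i ≤ 0 := h
      rw [le_antisymm h (p4 i), zero_mul]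
    · have h : s' i ≤ 0 := h
      rw [le_antisymm h (p5 i), mul_zero]
  -- No solution has this pattern, so `ε ≤ E`, and `E + 1 ≤ (1 + ε⁻¹) * E` makes the coarse bound
  -- linear.
  · obtain ⟨K, hK0, hK⟩ := h₀.exists_error_bound_polyhedral hH
    refine ⟨K * (1 + ε⁻¹), by positivity, fun E x y s hE hx hs hx0 hs0 hα hα' hxs => ?_⟩
    obtain ⟨r1, r2⟩ := hres E x y s hE hx hs hx0 hs0 hα hα'
    obtain ⟨x', y', s', h, hd⟩ := hK E x y s hE hx hs hx0 hs0 hxs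
    refine ⟨x', y', s', h, hd.trans ?_⟩
    rw [mul_assoc]
    refine mul_le_mul_of_nonneg_left ?_ hK0
    have h1 : 1 ≤ ε⁻¹ * E := by
      rw [inv_mul_eq_div, one_le_div hε]
      exact hinf E _ r1 r2
    linarith

/-- A global error bound for the solution set in terms of the natural residual, the violation of
the bounds and the complementarity gap. -/
theorem IsKKT.exists_error_bound (hH : P.H.PosSemidef) {x₀ s₀ : Fin n → ℝ}
    {y₀ : Fin m → ℝ} (h₀ : P.IsKKT x₀ y₀ s₀) :
    ∃ K, 0 ≤ K ∧ ∀ E x y s, 0 ≤ E → P.A *ᵥ x = P.b → P.Aᵀ *ᵥ y + s - P.H *ᵥ x = P.c →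
      (∀ i, -E ≤ x i) → (∀ i, -E ≤ s i) → (∀ i, x i ≤ E ∨ s i ≤ E) → x ⬝ᵥ s ≤ E →
      ∃ x' y' s', P.IsKKT x' y' s' ∧ ‖x - x'‖ ≤ K * E ∧ ‖s - s'‖ ≤ K * E := by
  classical
  choose K hK0 hK using h₀.exists_error_bound_of_pattern hH
  refine ⟨∑ α, K α, Finset.sum_nonneg fun α _ => hK0 α,
    fun E x y s hE hx hs hx0 hs0 hα hxs => ?_⟩
  set α : Finset (Fin n) := Finset.univ.filter fun i => x i ≤ E with hαd
  obtain ⟨x', y', s', h, hd⟩ := hK α E x y s hE hx hs hx0 hs0 (fun i hi => by simpa [hαd] using hi)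
    (fun i hi => (hα i).resolve_left (by simpa [hαd] using hi)) hxs
  have hle : K α * E ≤ (∑ α, K α) * E := mul_le_mul_of_nonneg_right
    (Finset.single_le_sum (fun α _ => hK0 α) (Finset.mem_univ α)) hE
  exact ⟨x', y', s', h, (norm_fst_le _).trans (hd.trans hle),
    ((norm_snd_le _).trans (norm_snd_le _)).trans (hd.trans hle)⟩

end Data

/-! ### Residuals on the neighbourhood of the perturbed central path. -/

theorem enorm₂_sq (v : Fin n → ℝ) : enorm₂ v ^ 2 = ∑ i, v i ^ 2 := by
  rw [enorm₂, EuclideanSpace.norm_sq_eq]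
  simp

theorem enorm₂_nonneg (v : Fin n → ℝ) : 0 ≤ enorm₂ v := norm_nonneg _

theorem abs_le_enorm₂ (v : Fin n → ℝ) (i : Fin n) : |v i| ≤ enorm₂ v := by
  refine abs_le_of_sq_le_sq ?_ (enorm₂_nonneg v)
  rw [enorm₂_sq]
  exact Finset.single_le_sum (f := fun i => v i ^ 2) (fun i _ => sq_nonneg _) (Finset.mem_univ i)

theorem enorm₂_le (v : Fin n → ℝ) : enorm₂ v ≤ n * ‖v‖ := by
  refine le_of_abs_le (abs_le_of_sq_le_sq ?_ (by positivity))
  rw [enorm₂_sq]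
  calc ∑ i, v i ^ 2 ≤ ∑ _i : Fin n, ‖v‖ ^ 2 := Finset.sum_le_sum fun i _ => by
        rw [← sq_abs]
        exact pow_le_pow_left₀ (abs_nonneg _) (norm_le_pi_norm v i) 2
    _ = n * ‖v‖ ^ 2 := by simp
    _ ≤ (n * ‖v‖) ^ 2 := by
        rw [mul_pow]
        refine mul_le_mul_of_nonneg_right ?_ (sq_nonneg _)
        rcases n.eq_zero_or_pos with rfl | h
        · simp
        · exact le_self_pow₀ (by exact_mod_cast h) two_ne_zero

theorem C₂_pos (hn : 0 < n) {γ : ℝ} (hγ : 0 < γ) : 0 < C₂ n γ := by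
  have : (0 : ℝ) < n := by exact_mod_cast hn
  unfold C₂
  positivity

/-- The residual bound `C₂ √μ max(√μ, 1) + 4 ‖λ‖ max(‖λ‖, 1)`. -/
def residualBound (n : ℕ) (γ μ l : ℝ) : ℝ :=
  C₂ n γ * Real.sqrt μ * max (Real.sqrt μ) 1 + 4 * l * max l 1

namespace Data

variable {P : Data m n}

theorem StrictlyFeasible.muLam_pos (hn : 0 < n) {lam x s : Fin n → ℝ} {y : Fin m → ℝ}
    (h : P.StrictlyFeasible lam x y s) : 0 < muLam lam x s := by
  have : Nonempty (Fin n) := ⟨⟨0, hn⟩⟩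
  refine div_pos (Finset.sum_pos (fun i _ => mul_pos (h.2.2.1 i) (h.2.2.2 i))
    Finset.univ_nonempty) (by exact_mod_cast hn)

/-- The residuals of a point of the neighbourhood are at most `residualBound`. -/
theorem InNeighbourhood.residual_le (hn : 0 < n) {γ : ℝ} (hγ : 0 < γ) {lam x s : Fin n → ℝ}
    {y : Fin m → ℝ} (hlam : ∀ i, 0 ≤ lam i) (h : P.InNeighbourhood γ lam x y s) :
    0 < residualBound n γ (muLam lam x s) (enorm₂ lam) ∧
    (∀ i, -residualBound n γ (muLam lam x s) (enorm₂ lam) ≤ x i) ∧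
    (∀ i, -residualBound n γ (muLam lam x s) (enorm₂ lam) ≤ s i) ∧
    (∀ i, x i ≤ residualBound n γ (muLam lam x s) (enorm₂ lam) ∨
      s i ≤ residualBound n γ (muLam lam x s) (enorm₂ lam)) ∧
    x ⬝ᵥ s ≤ residualBound n γ (muLam lam x s) (enorm₂ lam) := by
  have hn' : (1 : ℝ) ≤ n := by exact_mod_cast hn
  have hμ := h.1.muLam_pos hn
  have hxs : x ⬝ᵥ s ≤ n * muLam lam x s + enorm₂ lam ^ 2 := by
    have h1 : n * muLam lam x s = (x + lam) ⬝ᵥ (s + lam) := by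
      rw [muLam]
      field_simp
    rw [h1, enorm₂_sq]
    simp only [dotProduct, ← Finset.sum_add_distrib]
    -- Coordinatewise, `x s = (x + λ)(s + λ) - λ (x + λ) - λ (s + λ) + λ²`.
    refine Finset.sum_le_sum fun i _ => ?_
    have e1 := mul_nonneg (hlam i) (h.1.2.2.1 i).le
    have e2 := mul_nonneg (hlam i) (h.1.2.2.2 i).le
    simp only [Pi.add_apply]
    nlinarith
  have hle := fun i => (le_abs_self (lam i)).trans (abs_le_enorm₂ lam i)
  have hl := enorm₂_nonneg lam
  set μ := muLam lam x s
  set l := enorm₂ lam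
  set q := Real.sqrt μ with hq
  have hq0 : 0 < q := Real.sqrt_pos.2 hμ
  have hqq : q * q = μ := Real.mul_self_sqrt hμ.le
  have hC := C₂_pos hn hγ
  have hCn : (n : ℝ) ≤ C₂ n γ := le_add_of_nonneg_left (Real.sqrt_nonneg _)
  have b1 : l + l * l ≤ 4 * l * max l 1 := by
    have e1 := mul_le_mul_of_nonneg_left (le_max_left l 1) hl
    have e2 := mul_le_mul_of_nonneg_left (le_max_right l 1) hl
    linarith
  have b2 : C₂ n γ * q ≤ C₂ n γ * q * max q 1 :=
    le_mul_of_one_le_right (by positivity) (le_max_right _ _)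
  have b3 : n * μ ≤ C₂ n γ * q * max q 1 := by
    rw [← hqq, ← mul_assoc]
    gcongr
    exact le_max_left _ _
  have b4 : 0 < C₂ n γ * q := by positivity
  have b5 : 0 ≤ l * l := by positivity
  -- The two terms of `C₂` have separate roles: `√(n/γ)` bounds `min (x i) (s i)`, and `n` bounds
  -- the gap `n * μ`.
  have b6 : Real.sqrt (μ / γ) ≤ C₂ n γ * q := by
    have e1 : Real.sqrt (μ / γ) ≤ Real.sqrt (n / γ) * q := by
      rw [hq, ← Real.sqrt_mul (by positivity)]
      refine Real.sqrt_le_sqrt ?_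
      rw [div_mul_eq_mul_div]
      gcongr
      exact le_mul_of_one_le_left hμ.le hn'
    refine e1.trans (mul_le_mul_of_nonneg_right ?_ hq0.le)
    exact le_add_of_nonneg_right (by positivity)
  unfold residualBound
  refine ⟨by linarith, fun i => ?_, fun i => ?_, fun i => ?_, ?_⟩
  · linarith [h.1.2.2.1 i, hle i]
  · linarith [h.1.2.2.2 i, hle i]
  · by_contra! hcon
    have e1 : Real.sqrt (μ / γ) < x i + lam i := by linarith [hlam i, hcon.1]
    have e2 : Real.sqrt (μ / γ) < s i + lam i := by linarith [hlam i, hcon.2]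
    have e3 := mul_lt_mul'' e1 e2 (Real.sqrt_nonneg _) (Real.sqrt_nonneg _)
    rw [Real.mul_self_sqrt (by positivity)] at e3
    exact absurd (h.2 i).2 (not_le.2 e3)
  · nlinarith

theorem exists_isErrorBound (hn : 0 < n) (hH : P.H.PosSemidef)
    (hsol : ∃ x y s, P.IsOptimal x y s) : ∃ τ : ℝ, 0 < τ ∧ P.IsErrorBound τ τ := by
  obtain ⟨x₀, _, _, ⟨hx₀, hmin⟩, -⟩ := hsol
  obtain ⟨y₀, s₀, h₀⟩ := exists_isKKT hH hx₀ hmin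
  obtain ⟨K, hK0, hK⟩ := h₀.exists_error_bound hH
  -- The factor `n` passes from the sup norm to the Euclidean norm; the `+ 1` makes the inequality
  -- strict, as the residual bound is positive.
  refine ⟨n * K + 1, by positivity, fun γ lam x y s hγ _ hlam h => ?_⟩
  obtain ⟨hE, r1, r2, r3, r4⟩ := h.residual_le hn hγ hlam
  obtain ⟨x', y', s', hopt, dx, ds⟩ := hK _ x y s hE.le h.1.1 h.1.2.1 r1 r2 r3 r4
  have key : ∀ v : Fin n → ℝ, ‖v‖ ≤ K * residualBound n γ (muLam lam x s) (enorm₂ lam) →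
      enorm₂ v < (n * K + 1) * residualBound n γ (muLam lam x s) (enorm₂ lam) := fun v hv => by
    have e1 := mul_le_mul_of_nonneg_left hv (Nat.cast_nonneg (α := ℝ) n)
    linarith [enorm₂_le v]
  exact ⟨x', y', s', hopt.isOptimal hH, key _ dx, key _ ds⟩

end Data

/-! ### Prediction of the active sets. -/

/-- Both maxima equal `1` here, and the `μ` and `λ` terms each contribute less than `C / 2`. -/
theorem residualBound_mul_lt (hn : 0 < n) {γ μ l C τ : ℝ} (hγ : 0 < γ) (hC : 0 < C) (hτ : 0 < τ)
    (hl : l < min 1 (C / (8 * τ)))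
    (hμ : μ < min 1 ((C / (2 * τ * C₂ n γ)) ^ 2)) :
    τ * residualBound n γ μ l < C := by
  rw [lt_min_iff] at hl hμ
  have hC₂ := C₂_pos hn hγ
  have h1 : Real.sqrt μ < C / (2 * τ * C₂ n γ) := (Real.sqrt_lt' (by positivity)).2 hμ.2
  have h2 : Real.sqrt μ ≤ 1 := Real.sqrt_le_one.2 hμ.1.le
  rw [residualBound, max_eq_right h2, max_eq_right hl.1.le]
  rw [lt_div_iff₀ (by positivity)] at h1
  have h3 := hl.2
  rw [lt_div_iff₀ (by positivity)] at h3
  linarith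

end PerturbedQP

end

theorem mainTheorem6 {m n : ℕ} (hn : 0 < n) (P : PerturbedQP.Data m n)
    (hH : P.H.PosSemidef)
    (hsol : ∃ x y s, P.IsOptimal x y s) :
    (∃ τp τd : ℝ, 0 < τp ∧ 0 < τd ∧ P.IsErrorBound τp τd) ∧
    ∀ τp τd : ℝ, 0 < τp → 0 < τd → P.IsErrorBound τp τd →
      ∀ (γ : ℝ), 0 < γ → γ < 1 →
      ∀ (C : ℝ), 0 < C →
      ∀ (lam : Fin n → ℝ), (∀ i, 0 ≤ lam i) →
        0 < PerturbedQP.enorm₂ lam →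
        PerturbedQP.enorm₂ lam < min 1 (C / (8 * max τp τd)) →
      ∀ (x : Fin n → ℝ) (y : Fin m → ℝ) (s : Fin n → ℝ),
        P.InNeighbourhood γ lam x y s →
        PerturbedQP.muLam lam x s
          < min 1 ((C / (2 * max τp τd * PerturbedQP.C₂ n γ)) ^ 2) →
        ∃ xs ys ss, P.IsOptimal xs ys ss ∧
          PerturbedQP.predInactiveSet C x ⊆ PerturbedQP.inactiveSet xs ∧
          PerturbedQP.predStronglyActiveSet C s ⊆ PerturbedQP.stronglyActiveSet ss ∧
          PerturbedQP.remainingSet xs ss ⊆ PerturbedQP.predRemainingSet C x s := by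
  refine ⟨?_, ?_⟩
  · obtain ⟨τ, hτ, h⟩ := PerturbedQP.Data.exists_isErrorBound hn hH hsol
    exact ⟨τ, τ, hτ, hτ, h⟩
  intro τp τd hτp hτd hτ γ hγ hγ1 C hC lam hlam _ hl x y s h hμ
  obtain ⟨x', y', s', hopt, dx, ds⟩ := hτ γ lam x y s hγ hγ1 hlam h
  have hE := (h.residual_le hn hγ hlam).1
  have hlt := PerturbedQP.residualBound_mul_lt hn hγ hC (lt_max_of_lt_left hτp) hl hμ
  -- Each coordinate moves by less than `C`, so one that is at least `C` remains positive.
  have pos : ∀ (τ : ℝ) (z z' : Fin n → ℝ), τ ≤ max τp τd →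
      PerturbedQP.enorm₂ (z - z') < τ * PerturbedQP.residualBound n γ
        (PerturbedQP.muLam lam x s) (PerturbedQP.enorm₂ lam) →
      ∀ i, C ≤ z i → 0 < z' i := fun τ z z' hτ hz i hi => by
    have e1 := mul_le_mul_of_nonneg_right hτ hE.le
    have e2 := (le_abs_self _).trans (PerturbedQP.abs_le_enorm₂ (z - z') i)
    rw [Pi.sub_apply] at e2
    linarith
  have hI := pos τp x x' (le_max_left _ _) dx
  have hS := pos τd s s' (le_max_right _ _) ds
  exact ⟨x', y', s', hopt, hI, hS,
    Set.compl_subset_compl.2 (Set.union_subset_union hS hI)⟩
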